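/- Let $G$ be a (real, finite-dimensional, Hausdorff) Lie group with a $C^\infty$ left action on a Hausdorff $C^\infty$ manifold $M$ of dimension $n$ without boundary ($M$ and $G$ need be neither connected nor second countable). For $\ell\ge 1$ let $\mathcal F^\ell M$ be the $\ell$-th order frame bundle of $M$, whose points are the $\ell$-jets at $0$, $j^\ell_0 f$, of smooth maps $f$ from a neighbourhood of $0$ in $\mathbb R^n$ to $M$ that are local diffeomorphisms at $0$; let $G$ act on $\mathcal F^\ell M$ by prolongation, $g\cdot j^\ell_0 f:=j^\ell_0(x\mapsto g f(x))$. Assume that the $G$-action on $M$ is component effective, i.e. for every $g\in G$ with $g\ne 1$ and every connected component $M^\circ$ of $M$ there is $x\in M^\circ$ with $gx\ne x$. Assume also that for every $q\in M$ the stabilizer $\mathrm{Stab}_G(q)=\{g\in G: gq=q\}$ is compact. Then for every integer $\ell\ge 1$ the $G$-action on $\mathcal F^\ell M$ is free: for every $x\in\mathcal F^\ell M$, $\mathrm{Stab}_G(x)=\{1\}$. -/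

import Mathlib

open scoped Manifold ContDiff Topology

noncomputable section

/-- The action of `G` on the topological space `X` is component effective: every nontrivial
element of `G` moves some point of every connected component of `X`. -/
def ComponentEffective (G X : Type*) [Group G] [TopologicalSpace X] [MulAction G X] : Prop :=
  ∀ g : G, g ≠ 1 → ∀ x₀ : X, ∃ x ∈ connectedComponent x₀, g • x ≠ x

section FrameBundle

variable (n ℓ : ℕ) (M : Type*) [TopologicalSpace M] [ChartedSpace (EuclideanSpace ℝ (Fin n)) M]

/-- Smooth parametrizations of `M` near the origin of `ℝⁿ`, given as functions `ℝⁿ → M` that are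
smooth local diffeomorphisms at `0`; their values away from `0` are irrelevant. -/
def LocalParam : Type _ :=
  {f : EuclideanSpace ℝ (Fin n) → M // IsLocalDiffeomorphAt (𝓡 n) (𝓡 n) ∞ f 0}

variable {n M}

/-- Two parametrizations have the same `ℓ`-jet at `0`: they have the same value `p` there and, read
in the preferred chart at `p`, the same derivatives at `0` up to order `ℓ`. -/
def SameJet (f g : EuclideanSpace ℝ (Fin n) → M) : Prop :=
  f 0 = g 0 ∧ ∀ k ≤ ℓ,
    iteratedFDeriv ℝ k (extChartAt (𝓡 n) (f 0) ∘ f) 0 =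
      iteratedFDeriv ℝ k (extChartAt (𝓡 n) (f 0) ∘ g) 0

variable (n M)

/-- Equality of `ℓ`-jets at `0` as an equivalence relation on smooth local parametrizations. -/
def jetSetoid : Setoid (LocalParam n M) where
  r f g := SameJet ℓ f.1 g.1
  iseqv :=
    { refl := fun _ => ⟨rfl, fun _ _ => rfl⟩
      symm := fun {f g} h => ⟨h.1.symm, fun k hk => by rw [← h.1]; exact (h.2 k hk).symm⟩
      trans := fun {f g e} h h' => ⟨h.1.trans h'.1, fun k hk => by
        have := h'.2 k hk
        rw [← h.1] at this
        exact (h.2 k hk).trans this⟩ }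

/-- The set of points of the `ℓ`-th order frame bundle of the `n`-dimensional manifold `M`: the
`ℓ`-jets at `0` of smooth local diffeomorphisms `(ℝⁿ, 0) → M`. -/
def FrameBundle : Type _ := Quotient (jetSetoid n ℓ M)

variable {n M}

/-- Composition with a smooth map preserves equality of jets. -/
theorem SameJet.comp [IsManifold (𝓡 n) ∞ M] {ℓ : ℕ} {f g : EuclideanSpace ℝ (Fin n) → M}
    (hf : ContMDiffAt (𝓡 n) (𝓡 n) ∞ f 0) (hg : ContMDiffAt (𝓡 n) (𝓡 n) ∞ g 0)
    (h : SameJet ℓ f g) {Φ : M → M} (hΦ : ContMDiff (𝓡 n) (𝓡 n) ∞ Φ) :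
    SameJet ℓ (Φ ∘ f) (Φ ∘ g) := by
  obtain ⟨h0, hd⟩ := h
  refine ⟨by simp [h0], fun k hk => ?_⟩
  set φ := extChartAt (𝓡 n) (f 0) with hφ
  set ψ := extChartAt (𝓡 n) ((Φ ∘ f) 0) with hψ
  have key : ∀ e : EuclideanSpace ℝ (Fin n) → M, ContMDiffAt (𝓡 n) (𝓡 n) ∞ e 0 → e 0 = f 0 →
      iteratedFDeriv ℝ k (ψ ∘ Φ ∘ e) 0 =
        (ftaylorSeries ℝ (ψ ∘ Φ ∘ φ.symm) (φ (f 0))).taylorComp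
          (ftaylorSeries ℝ (φ ∘ e) 0) k := by
    intro e he he0
    have hφe : ContDiffAt ℝ ∞ (φ ∘ e) 0 := by
      rw [← contMDiffAt_iff_contDiffAt]
      refine ContMDiffAt.comp (I' := 𝓡 n) (0 : EuclideanSpace ℝ (Fin n)) ?_ he
      rw [he0]
      exact contMDiffAt_extChartAt
    have hmid : ContDiffAt ℝ ∞ (ψ ∘ Φ ∘ φ.symm) (φ (f 0)) := by
      rw [← contMDiffAt_iff_contDiffAt]
      have hsymm : ContMDiffAt (𝓡 n) (𝓡 n) ∞ φ.symm (φ (f 0)) :=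
        (contMDiffOn_extChartAt_symm (f 0)).contMDiffAt (extChartAt_target_mem_nhds (f 0))
      have hpt : φ.symm (φ (f 0)) = f 0 := extChartAt_to_inv (I := 𝓡 n) (f 0)
      refine ContMDiffAt.comp (I' := 𝓡 n) _ ?_
        (ContMDiffAt.comp (I' := 𝓡 n) _ hΦ.contMDiffAt hsymm)
      rw [Function.comp_apply, hpt]
      exact contMDiffAt_extChartAt
    have hev : ψ ∘ Φ ∘ e =ᶠ[𝓝 0] (ψ ∘ Φ ∘ φ.symm) ∘ (φ ∘ e) := by
      have hs : φ.source ∈ 𝓝 (e 0) := by rw [he0]; exact extChartAt_source_mem_nhds (f 0)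
      filter_upwards [he.continuousAt hs] with x hx
      simp [φ.left_inv hx]
    rw [hev.iteratedFDeriv ℝ k |>.eq_of_nhds]
    have hpt0 : (φ ∘ e) 0 = φ (f 0) := by simp [he0]
    rw [← hpt0] at hmid ⊢
    exact iteratedFDeriv_comp hmid hφe (by exact_mod_cast le_top)
  rw [key f hf rfl, key g hg h0.symm]
  simp only [FormalMultilinearSeries.taylorComp]
  refine Finset.sum_congr rfl fun c _ => ?_
  have hp : (fun m => ftaylorSeries ℝ (φ ∘ f) 0 (c.partSize m)) =
      fun m => ftaylorSeries ℝ (φ ∘ g) 0 (c.partSize m) :=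
    funext fun m => hd _ ((c.partSize_le m).trans hk)
  exact congrArg (c.compAlongOrderedFinpartition
    (ftaylorSeries ℝ (ψ ∘ Φ ∘ φ.symm) (φ (f 0)) c.length)) hp

/-- The prolonged action on the `ℓ`-th order frame bundle of a smooth action of `G` on `M`: the
element `g` sends the `ℓ`-jet at `0` of `f` to the `ℓ`-jet at `0` of `x ↦ g • f x`. -/
@[reducible] def prolongedAction (n ℓ : ℕ) (F : Type*) [NormedAddCommGroup F] [NormedSpace ℝ F]
    (G : Type*) [TopologicalSpace G] [ChartedSpace F G] [Group G]
    (M : Type*) [TopologicalSpace M] [ChartedSpace (EuclideanSpace ℝ (Fin n)) M]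
    [IsManifold (𝓡 n) ∞ M] [MulAction G M] [ContMDiffSMul 𝓘(ℝ, F) (𝓡 n) ∞ G M] :
    MulAction G (FrameBundle n ℓ M) where
  smul g := Quotient.map'
    (fun f => ⟨fun x => g • f.1 x,
      IsLocalDiffeomorphAt.comp (K := 𝓡 n) (P := M) f.2
        ((Diffeomorph.smul 𝓘(ℝ, F) (𝓡 n) ∞ g).isLocalDiffeomorph (f.1 0))⟩)
    (fun f f' h => SameJet.comp f.2.contMDiffAt f'.2.contMDiffAt h
      (ContMDiffSMul.contMDiff_const_smul (I := 𝓘(ℝ, F)) g))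
  one_smul x := by
    induction x using Quotient.inductionOn with
    | h f => exact congrArg (Quotient.mk _) (Subtype.ext (funext fun x => one_smul G (f.1 x)))
  mul_smul g h x := by
    induction x using Quotient.inductionOn with
    | h f => exact congrArg (Quotient.mk _) (Subtype.ext (funext fun x => mul_smul g h (f.1 x)))

end FrameBundle

end

open Filter Set Function

/-! An element `g` fixing an `ℓ`-jet fixes its base point `q` and, as `ℓ ≥ 1`, has identity
derivative there (`SameJet.hasFDerivAt_chartConj`). So does every power `g ^ k`, and all powers lie
in the compact stabilizer of `q`. Hence, on one ball around `q` in a chart, all `g ^ k` are bounded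
and `C¹`-close to the identity. Were `g x ≠ x` there, each step from `g ^ k x` to `g ^ (k + 1) x`
would nearly equal `g x - x`, and the orbit would drift out of the bounded region
(`eq_self_of_bounded_of_norm_fderiv_sub_id_le`). So `g` is trivial near `q`
(`eventually_smul_eq_self`).

The points near which `g` is trivial form an open set. It is closed because identity derivatives
pass to limit points, where the local argument applies again. It thus contains the component of `q`,
and component effectiveness gives `g = 1`. -/

/-- The self-map `Φ` of `M` read in the preferred chart at `q`. -/
noncomputable def chartConj {n : ℕ} {M : Type*} [TopologicalSpace M]
    [ChartedSpace (EuclideanSpace ℝ (Fin n)) M] (q : M) (Φ : M → M) :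
    EuclideanSpace ℝ (Fin n) → EuclideanSpace ℝ (Fin n) :=
  extChartAt (𝓡 n) q ∘ Φ ∘ (extChartAt (𝓡 n) q).symm

/-! ### Self-maps read in a chart at a fixed point -/

section ChartConj

variable {n : ℕ} {M : Type*} [TopologicalSpace M] [ChartedSpace (EuclideanSpace ℝ (Fin n)) M]

theorem chartConj_apply_self {q : M} {Φ : M → M} (h : Φ q = q) :
    chartConj q Φ (extChartAt (𝓡 n) q q) = extChartAt (𝓡 n) q q := by
  simp [chartConj, h]

theorem tendsto_extChartAt_symm_self (q : M) :
    Tendsto (extChartAt (𝓡 n) q).symm (𝓝 (extChartAt (𝓡 n) q q)) (𝓝 q) := by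
  have h : ContinuousAt (extChartAt (𝓡 n) q).symm (extChartAt (𝓡 n) q q) :=
    continuousAt_extChartAt_symm q
  rw [ContinuousAt, extChartAt_to_inv] at h
  exact h

theorem eventually_map_extChartAt_symm_mem_source {q : M} {Φ : M → M} (hΦ : ContinuousAt Φ q)
    (h : Φ q = q) :
    ∀ᶠ y in 𝓝 (extChartAt (𝓡 n) q q),
      Φ ((extChartAt (𝓡 n) q).symm y) ∈ (extChartAt (𝓡 n) q).source := by
  have h1 : Tendsto Φ (𝓝 q) (𝓝 q) := by simpa [ContinuousAt, h] using! hΦ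
  exact (h1.comp (tendsto_extChartAt_symm_self q)) (extChartAt_source_mem_nhds q)

theorem chartConj_comp_eventuallyEq {q : M} {Φ Ψ : M → M} (hΦ : ContinuousAt Φ q)
    (h : Φ q = q) :
    chartConj q (Ψ ∘ Φ) =ᶠ[𝓝 (extChartAt (𝓡 n) q q)] chartConj q Ψ ∘ chartConj q Φ := by
  filter_upwards [eventually_map_extChartAt_symm_mem_source hΦ h] with y hy
  simp only [chartConj, comp_apply, (extChartAt (𝓡 n) q).left_inv hy]

/-- Chain rule at the common fixed point: near it, conjugation by the chart respects composition. -/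
theorem HasFDerivAt.chartConj_iterate {q : M} {Φ : M → M} (hΦ : ContinuousAt Φ q)
    (h : Φ q = q)
    (hd : HasFDerivAt (chartConj q Φ) (ContinuousLinearMap.id ℝ _) (extChartAt (𝓡 n) q q))
    (k : ℕ) :
    HasFDerivAt (chartConj q Φ^[k]) (ContinuousLinearMap.id ℝ _) (extChartAt (𝓡 n) q q) := by
  induction k with
  | zero =>
    refine (hasFDerivAt_id _).congr_of_eventuallyEq ?_
    filter_upwards [extChartAt_target_mem_nhds (I := 𝓡 n) q] with y hy
    exact (extChartAt (𝓡 n) q).right_inv hy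
  | succ k ih =>
    rw [iterate_succ]
    refine HasFDerivAt.congr_of_eventuallyEq ?_ (chartConj_comp_eventuallyEq hΦ h)
    have ih' := ih
    rw [← chartConj_apply_self h] at ih'
    exact ih'.comp _ hd

/-- A map which is the identity near points accumulating at `q` has identity derivative at `q`. -/
theorem hasFDerivAt_chartConj_of_mem_closure {q : M} {Φ : M → M}
    (hΦ : ContDiffAt ℝ 1 (chartConj q Φ) (extChartAt (𝓡 n) q q))
    (hq : q ∈ closure {x | ∀ᶠ z in 𝓝 x, Φ z = z}) :
    HasFDerivAt (chartConj q Φ) (ContinuousLinearMap.id ℝ _) (extChartAt (𝓡 n) q q) := by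
  have hcont : ContinuousAt (fderiv ℝ (chartConj q Φ)) (extChartAt (𝓡 n) q q) :=
    (hΦ.fderiv_right (m := 0) (by simp)).continuousAt
  have hid : fderiv ℝ (chartConj q Φ) (extChartAt (𝓡 n) q q) = ContinuousLinearMap.id ℝ _ := by
    have hfreq : ∃ᶠ x in 𝓝 q, fderiv ℝ (chartConj q Φ) (extChartAt (𝓡 n) q x) =
        ContinuousLinearMap.id ℝ _ := by
      refine ((mem_closure_iff_frequently.1 hq).and_eventually
        (extChartAt_source_mem_nhds (I := 𝓡 n) q)).mono ?_
      rintro x ⟨hx, hxs⟩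
      have hev : chartConj q Φ =ᶠ[𝓝 (extChartAt (𝓡 n) q x)] id := by
        have h1 : ContinuousAt (extChartAt (𝓡 n) q).symm (extChartAt (𝓡 n) q x) :=
          continuousAt_extChartAt_symm' hxs
        rw [ContinuousAt, (extChartAt (𝓡 n) q).left_inv hxs] at h1
        filter_upwards [h1.eventually hx, extChartAt_target_mem_nhds' (I := 𝓡 n)
          ((extChartAt (𝓡 n) q).map_source hxs)] with y hy hyt
        simp only [chartConj, comp_apply, hy, (extChartAt (𝓡 n) q).right_inv hyt, id]
      rw [hev.fderiv_eq, fderiv_id]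
    -- The derivative equals the identity at points accumulating at `q`, and it is continuous there.
    exact (isClosed_singleton (x := ContinuousLinearMap.id ℝ _)).mem_of_frequently_of_tendsto
      hfreq (hcont.tendsto.comp (continuousAt_extChartAt q))
  rw [← hid]
  exact (hΦ.differentiableAt one_ne_zero).hasFDerivAt

end ChartConj

/-! ### The drift estimate -/

/-- If all iterates of a map `f` near `x` are represented by maps which stay bounded and are close
to the identity in the `C¹` sense on a ball, then `f` is the identity on the part of the ball which
it maps to the ball. -/
theorem eq_self_of_bounded_of_norm_fderiv_sub_id_le {E : Type*} [NormedAddCommGroup E]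
    [NormedSpace ℝ E] {s : Set E} (hs : Convex ℝ s) {f : ℕ → E → E} {x y : E} (hx : x ∈ s)
    (hy : y ∈ s) (hf : ∀ k, ∀ z ∈ s, DifferentiableAt ℝ (f k) z)
    (hf' : ∀ k, ∀ z ∈ s, ‖fderiv ℝ (f k) z - ContinuousLinearMap.id ℝ E‖ ≤ 1 / 2)
    {c : E} {R : ℝ} (hb : ∀ k, ‖f k x - c‖ ≤ R) (hstep : ∀ k, f k y = f (k + 1) x) :
    y = x := by
  -- Telescoping: `f (k + 1) x - f k x = f k y - f k x` is within `‖y - x‖ / 2` of `y - x`, by the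
  -- mean value inequality for `f k - id`.
  have hk : ∀ k, ‖f k x - f 0 x - (k : ℝ) • (y - x)‖ ≤ k * (1 / 2 * ‖y - x‖) := by
    intro k
    induction k with
    | zero => simp
    | succ k ih =>
      have h1 := hs.norm_image_sub_le_of_norm_fderiv_le' (hf k) (hf' k) hx hy
      rw [hstep] at h1
      calc ‖f (k + 1) x - f 0 x - ((k + 1 : ℕ) : ℝ) • (y - x)‖
          = ‖(f (k + 1) x - f k x - (y - x)) + (f k x - f 0 x - (k : ℝ) • (y - x))‖ := by
            congr 1; push_cast; module
        _ ≤ 1 / 2 * ‖y - x‖ + k * (1 / 2 * ‖y - x‖) := norm_add_le_of_le h1 ih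
        _ = _ := by push_cast; ring
  by_contra hne
  have hpos : 0 < ‖y - x‖ := norm_pos_iff.2 (sub_ne_zero.2 hne)
  -- The drift is at least `k * ‖y - x‖ / 2`, while boundedness allows at most `2 * R`.
  obtain ⟨k, hkR⟩ := exists_nat_gt (4 * R / ‖y - x‖)
  rw [div_lt_iff₀ hpos] at hkR
  have h2 : ‖f k x - f 0 x‖ ≤ R + R := by
    rw [← sub_sub_sub_cancel_right _ _ c]
    exact norm_sub_le_of_le (hb k) (hb 0)
  have h3 : ‖(k : ℝ) • (y - x)‖ ≤ ‖f k x - f 0 x‖ + ‖f k x - f 0 x - (k : ℝ) • (y - x)‖ := by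
    have := norm_sub_le (f k x - f 0 x) (f k x - f 0 x - (k : ℝ) • (y - x))
    rwa [sub_sub_cancel] at this
  rw [norm_smul, Real.norm_natCast] at h3
  linarith [hk k]

/-! ### Smooth actions with compact stabilizers -/

section SmoothAction

variable {F : Type*} [NormedAddCommGroup F] [NormedSpace ℝ F]
  {G : Type*} [TopologicalSpace G] [ChartedSpace F G] [Group G]
  {n : ℕ} {M : Type*} [TopologicalSpace M] [ChartedSpace (EuclideanSpace ℝ (Fin n)) M]
  [MulAction G M]

theorem continuousAt_const_smul_of_contMDiffSMul [ContMDiffSMul 𝓘(ℝ, F) (𝓡 n) ∞ G M]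
    (g : G) (q : M) :
    ContinuousAt (fun x : M => g • x) q :=
  (ContMDiffSMul.contMDiff_const_smul (I := 𝓘(ℝ, F)) (I' := 𝓡 n) (n := ∞) g).continuous.continuousAt

variable [IsManifold (𝓡 n) ∞ M]

/-- Smoothness is joint in the group coordinate and the point; this is what makes later estimates
locally uniform in the group element. -/
theorem contDiffAt_uncurry_chartConj_smul [IsManifold 𝓘(ℝ, F) ∞ G]
    [ContMDiffSMul 𝓘(ℝ, F) (𝓡 n) ∞ G M] {h : G} {q : M} (hq : h • q = q) :
    ContDiffAt ℝ ∞ (uncurry fun (a : F) =>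
      chartConj q (fun x : M => (extChartAt 𝓘(ℝ, F) h).symm a • x))
      (extChartAt 𝓘(ℝ, F) h h, extChartAt (𝓡 n) q q) := by
  rw [← contMDiffAt_iff_contDiffAt]
  set p₀ := (extChartAt 𝓘(ℝ, F) h h, extChartAt (𝓡 n) q q) with hp₀
  have h1 : ContMDiffAt 𝓘(ℝ, F × EuclideanSpace ℝ (Fin n)) 𝓘(ℝ, F) ∞
      (fun p : F × EuclideanSpace ℝ (Fin n) => (extChartAt 𝓘(ℝ, F) h).symm p.1) p₀ :=
    ContMDiffAt.comp (I' := 𝓘(ℝ, F)) p₀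
      ((contMDiffOn_extChartAt_symm h).contMDiffAt (extChartAt_target_mem_nhds (I := 𝓘(ℝ, F)) h))
      contDiff_fst.contMDiff.contMDiffAt
  have h2 : ContMDiffAt 𝓘(ℝ, F × EuclideanSpace ℝ (Fin n)) (𝓡 n) ∞
      (fun p : F × EuclideanSpace ℝ (Fin n) => (extChartAt (𝓡 n) q).symm p.2) p₀ :=
    ContMDiffAt.comp (I' := 𝓡 n) p₀
      ((contMDiffOn_extChartAt_symm q).contMDiffAt (extChartAt_target_mem_nhds (I := 𝓡 n) q))
      contDiff_snd.contMDiff.contMDiffAt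
  refine ContMDiffAt.comp (I' := 𝓡 n) (g := extChartAt (𝓡 n) q) p₀ ?_ (h1.smul h2)
  have hpt : (extChartAt 𝓘(ℝ, F) h).symm p₀.1 • (extChartAt (𝓡 n) q).symm p₀.2 = q := by
    simp [hp₀, hq]
  simp only [comp_apply, hpt]
  exact contMDiffAt_extChartAt

theorem contDiffAt_chartConj_smul [IsManifold 𝓘(ℝ, F) ∞ G]
    [ContMDiffSMul 𝓘(ℝ, F) (𝓡 n) ∞ G M] {g : G} {q : M} (hq : g • q = q) :
    ContDiffAt ℝ ∞ (chartConj q (fun x : M => g • x)) (extChartAt (𝓡 n) q q) := by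
  have h1 := (contDiffAt_uncurry_chartConj_smul (F := F) hq).comp (extChartAt (𝓡 n) q q)
    (contDiffAt_const.prodMk contDiffAt_id (x := extChartAt (𝓡 n) q q))
  refine h1.congr_of_eventuallyEq (Eventually.of_forall fun y => ?_)
  simp [uncurry]

/-- The derivatives of the action maps, read in a chart at a fixed point of `h`, are almost
constant near this point, uniformly near `h`. -/
theorem eventually_chartConj_smul_close [IsManifold 𝓘(ℝ, F) ∞ G]
    [ContMDiffSMul 𝓘(ℝ, F) (𝓡 n) ∞ G M] {h : G} {q : M} (hq : h • q = q) :
    ∀ᶠ z : EuclideanSpace ℝ (Fin n) × G in 𝓝 (extChartAt (𝓡 n) q q, h),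
      ‖chartConj q (fun x : M => z.2 • x) z.1 - extChartAt (𝓡 n) q q‖ ≤ 1 ∧
      DifferentiableAt ℝ (chartConj q (fun x : M => z.2 • x)) z.1 ∧
      ‖fderiv ℝ (chartConj q (fun x : M => z.2 • x)) z.1 -
        fderiv ℝ (chartConj q (fun x : M => z.2 • x)) (extChartAt (𝓡 n) q q)‖ ≤ 1 / 2 := by
  set y₀ := extChartAt (𝓡 n) q q with hy₀
  set a₀ := extChartAt 𝓘(ℝ, F) h h with ha₀
  set f : F → EuclideanSpace ℝ (Fin n) → EuclideanSpace ℝ (Fin n) := fun a =>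
    chartConj q (fun x : M => (extChartAt 𝓘(ℝ, F) h).symm a • x) with hf
  have hsm : ContDiffAt ℝ ∞ (uncurry f) (a₀, y₀) := contDiffAt_uncurry_chartConj_smul hq
  have hder : ContinuousAt (fun p : F × EuclideanSpace ℝ (Fin n) => fderiv ℝ (f p.1) p.2)
      (a₀, y₀) := by
    -- The parameter is the whole pair, of which `f` sees only the first entry; the second is the
    -- point of differentiation.
    have h1 : ContDiffAt ℝ 1 (uncurry fun p : F × EuclideanSpace ℝ (Fin n) => f p.1)
        ((a₀, y₀), y₀) :=
      (hsm.of_le (by exact_mod_cast le_top)).comp ((a₀, y₀), y₀)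
        (g := uncurry f) (f := fun p : (F × EuclideanSpace ℝ (Fin n)) × EuclideanSpace ℝ (Fin n) =>
          (p.1.1, p.2)) (by fun_prop)
    exact (ContDiffAt.fderiv (m := 0) (g := Prod.snd) h1 contDiffAt_snd (by simp)).continuousAt
  have hfa : f a₀ y₀ = y₀ := by simp [hf, chartConj, ha₀, hy₀, hq]
  have e1 : ∀ᶠ p in 𝓝 (a₀, y₀), ‖f p.1 p.2 - y₀‖ ≤ 1 := by
    have : Tendsto (fun p : F × EuclideanSpace ℝ (Fin n) => ‖f p.1 p.2 - y₀‖) (𝓝 (a₀, y₀))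
        (𝓝 ‖f a₀ y₀ - y₀‖) := (hsm.continuousAt.sub continuousAt_const).norm
    refine (this.eventually_lt_const (u := 1) ?_).mono fun _ => le_of_lt
    simp [hfa]
  have e2 : ∀ᶠ p in 𝓝 (a₀, y₀), DifferentiableAt ℝ (f p.1) p.2 := by
    refine ((hsm.of_le (m := 1) (by exact_mod_cast le_top)).eventually (by simp)).mono
      fun p hp => ?_
    exact DifferentiableAt.comp (g := uncurry f) p.2 (hp.differentiableAt one_ne_zero)
      (f := fun y => (p.1, y)) (by fun_prop)
  -- Both derivatives have the same group parameter, so their difference vanishes at `(a₀, y₀)`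
  -- whatever the derivative of `h` is.
  have e3 : ∀ᶠ p in 𝓝 (a₀, y₀), ‖fderiv ℝ (f p.1) p.2 - fderiv ℝ (f p.1) y₀‖ ≤ 1 / 2 := by
    have hc : ContinuousAt (fun p : F × EuclideanSpace ℝ (Fin n) => fderiv ℝ (f p.1) y₀)
        (a₀, y₀) :=
      ContinuousAt.comp (x := (a₀, y₀))
        (g := fun p : F × EuclideanSpace ℝ (Fin n) => fderiv ℝ (f p.1) p.2)
        (f := fun p : F × EuclideanSpace ℝ (Fin n) => (p.1, y₀)) hder (by fun_prop)
    have := (hder.sub hc).norm.tendsto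
    refine (this.eventually_lt_const (u := 1 / 2) ?_).mono fun _ => le_of_lt
    simp
  have ht : Tendsto (fun z : EuclideanSpace ℝ (Fin n) × G => (extChartAt 𝓘(ℝ, F) h z.2, z.1))
      (𝓝 (y₀, h)) (𝓝 (a₀, y₀)) :=
    ((continuousAt_extChartAt h).comp (x := (y₀, h)) (f := Prod.snd)
      continuousAt_snd).prodMk_nhds continuousAt_fst
  have hsrc : ∀ᶠ z : EuclideanSpace ℝ (Fin n) × G in 𝓝 (y₀, h),
      z.2 ∈ (extChartAt 𝓘(ℝ, F) h).source :=
    continuousAt_snd.preimage_mem_nhds (extChartAt_source_mem_nhds h)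
  filter_upwards [ht.eventually e1, ht.eventually e2, ht.eventually e3, hsrc] with z h1 h2 h3 hz
  simp only [hf, (extChartAt 𝓘(ℝ, F) h).left_inv hz] at h1 h2 h3
  exact ⟨h1, h2, h3⟩

/-- If `q` has compact stabilizer, then an element of the stabilizer whose derivative at `q` is the
identity acts trivially near `q`. -/
theorem eventually_smul_eq_self [IsManifold 𝓘(ℝ, F) ∞ G]
    [ContMDiffSMul 𝓘(ℝ, F) (𝓡 n) ∞ G M] {g : G} {q : M}
    (hK : IsCompact (MulAction.stabilizer G q : Set G)) (hq : g • q = q)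
    (hd : HasFDerivAt (chartConj q (fun x : M => g • x)) (ContinuousLinearMap.id ℝ _)
      (extChartAt (𝓡 n) q q)) :
    ∀ᶠ x in 𝓝 q, g • x = x := by
  have hcont := continuousAt_const_smul_of_contMDiffSMul (F := F) (n := n) g q
  -- Compactness of the stabilizer (tube lemma) gives one ball that serves all its elements, hence
  -- all powers of `g`.
  have hunif := hK.eventually_forall_of_forall_eventually (x₀ := extChartAt (𝓡 n) q q)
    (P := fun y h => ‖chartConj q (fun x : M => h • x) y - extChartAt (𝓡 n) q q‖ ≤ 1 ∧
      DifferentiableAt ℝ (chartConj q (fun x : M => h • x)) y ∧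
      ‖fderiv ℝ (chartConj q (fun x : M => h • x)) y -
        fderiv ℝ (chartConj q (fun x : M => h • x)) (extChartAt (𝓡 n) q q)‖ ≤ 1 / 2)
    fun h hh => eventually_chartConj_smul_close (F := F) (MulAction.mem_stabilizer_iff.1 hh)
  obtain ⟨r, hr, hball⟩ := Metric.eventually_nhds_iff_ball.1 hunif
  have hpow : ∀ k : ℕ, g ^ k ∈ MulAction.stabilizer G q := fun k =>
    pow_mem (MulAction.mem_stabilizer_iff.2 hq) k
  have hdk : ∀ k : ℕ, fderiv ℝ (chartConj q (fun x : M => g ^ k • x)) (extChartAt (𝓡 n) q q) =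
      ContinuousLinearMap.id ℝ _ := fun k => by
    rw [← smul_iterate]
    exact (HasFDerivAt.chartConj_iterate hcont hq hd k).fderiv
  have hφ : Tendsto (extChartAt (𝓡 n) q) (𝓝 q) (𝓝 (extChartAt (𝓡 n) q q)) :=
    continuousAt_extChartAt q
  have hg : Tendsto (fun x : M => g • x) (𝓝 q) (𝓝 q) := by
    simpa only [ContinuousAt, hq] using hcont
  have hsrc := extChartAt_source_mem_nhds (I := 𝓡 n) q
  have hB := Metric.ball_mem_nhds (extChartAt (𝓡 n) q q) hr
  filter_upwards [hsrc, hg hsrc, hφ hB, (hφ.comp hg) hB] with x hx hgx hxB hgxB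
  refine (extChartAt (𝓡 n) q).injOn hgx hx ?_
  refine eq_self_of_bounded_of_norm_fderiv_sub_id_le
    (convex_ball (extChartAt (𝓡 n) q q) r) (f := fun k => chartConj q (fun x : M => g ^ k • x))
    (c := extChartAt (𝓡 n) q q) (R := 1) hxB hgxB
    (fun k z hz => (hball z hz _ (hpow k)).2.1) (fun k z hz => ?_)
    (fun k => (hball _ hxB _ (hpow k)).1) fun k => ?_
  · rw [← hdk k]
    exact (hball z hz _ (hpow k)).2.2
  · simp only [chartConj, comp_apply, (extChartAt (𝓡 n) q).left_inv hx,
      (extChartAt (𝓡 n) q).left_inv hgx, pow_succ, mul_smul]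

/-- If all stabilizers are compact, then an element of `G` fixing a point with identity derivative
fixes its connected component pointwise. -/
theorem smul_eq_self_of_mem_connectedComponent [T2Space M] [IsManifold 𝓘(ℝ, F) ∞ G]
    [ContMDiffSMul 𝓘(ℝ, F) (𝓡 n) ∞ G M] {g : G} {q : M}
    (hK : ∀ q : M, IsCompact (MulAction.stabilizer G q : Set G)) (hq : g • q = q)
    (hd : HasFDerivAt (chartConj q (fun x : M => g • x)) (ContinuousLinearMap.id ℝ _)
      (extChartAt (𝓡 n) q q)) {x : M} (hx : x ∈ connectedComponent q) :
    g • x = x := by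
  have hopen : IsOpen {x : M | ∀ᶠ z in 𝓝 x, g • z = z} := isOpen_setOfPred_eventually_nhds
  have hclosed : IsClosed {x : M | ∀ᶠ z in 𝓝 x, g • z = z} := by
    refine isClosed_of_closure_subset fun y hy => ?_
    have hfix : IsClosed {x : M | g • x = x} :=
      isClosed_eq (continuous_iff_continuousAt.2
        (continuousAt_const_smul_of_contMDiffSMul (F := F) (n := n) g)) continuous_id
    have hgy : g • y = y :=
      closure_minimal (fun z hz => (mem_ofPred.1 hz).self_of_nhds) hfix hy
    -- The local result is applied at the limit point `y`, so the stabilizer of `y` must be compact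
    -- too.
    exact eventually_smul_eq_self (F := F) (n := n) (hK y) hgy (hasFDerivAt_chartConj_of_mem_closure
      ((contDiffAt_chartConj_smul (F := F) hgy).of_le (by exact_mod_cast le_top)) hy)
  have hmem : q ∈ {x : M | ∀ᶠ z in 𝓝 x, g • z = z} :=
    eventually_smul_eq_self (F := F) (n := n) (hK q) hq hd
  exact (mem_ofPred.1 (IsClopen.connectedComponent_subset ⟨hclosed, hopen⟩ hmem hx)).self_of_nhds

end SmoothAction

/-! ### From jets to derivatives -/

/-- A smooth map preserving the `1`-jet of a local parametrization has identity derivative. -/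
theorem SameJet.hasFDerivAt_chartConj {n : ℕ} {M : Type*} [TopologicalSpace M]
    [ChartedSpace (EuclideanSpace ℝ (Fin n)) M] [IsManifold (𝓡 n) ∞ M]
    {f : EuclideanSpace ℝ (Fin n) → M} (hf : IsLocalDiffeomorphAt (𝓡 n) (𝓡 n) ∞ f 0)
    {Φ : M → M} {ℓ : ℕ} (hℓ : 1 ≤ ℓ) (h : SameJet ℓ (Φ ∘ f) f)
    (hΦ : DifferentiableAt ℝ (chartConj (f 0) Φ) (extChartAt (𝓡 n) (f 0) (f 0))) :
    HasFDerivAt (chartConj (f 0) Φ) (ContinuousLinearMap.id ℝ _)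
      (extChartAt (𝓡 n) (f 0) (f 0)) := by
  obtain ⟨h0, hjet⟩ := h
  have h1 := hjet 1 hℓ
  rw [h0] at h1
  set φ := extChartAt (𝓡 n) (f 0) with hφ
  have hfd : fderiv ℝ (φ ∘ Φ ∘ f) 0 = fderiv ℝ (φ ∘ f) 0 := by
    ext1 v
    have := congrArg (fun m => m fun _ => v) h1
    simpa only [iteratedFDeriv_one_apply] using this
  have hdf : DifferentiableAt ℝ (φ ∘ f) 0 :=
    ((contMDiffAt_iff_contDiffAt.1 (ContMDiffAt.comp (I' := 𝓡 n)
      (0 : EuclideanSpace ℝ (Fin n)) contMDiffAt_extChartAt hf.contMDiffAt)).differentiableAt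
      (by simp))
  have hev : φ ∘ Φ ∘ f =ᶠ[𝓝 0] chartConj (f 0) Φ ∘ (φ ∘ f) := by
    filter_upwards [hf.contMDiffAt.continuousAt (extChartAt_source_mem_nhds (I := 𝓡 n) (f 0))]
      with x hx
    simp only [chartConj, comp_apply, ← hφ, φ.left_inv hx]
  rw [hev.fderiv_eq, fderiv_comp 0 hΦ hdf] at hfd
  -- Now `hfd` reads `D ∘ A = A`, with `A` the derivative of `φ ∘ f`; surjectivity of `A` forces `D
  -- = id`.
  have hsurj : Surjective (fderiv ℝ (φ ∘ f) 0) := by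
    have hf' : DifferentiableAt ℝ (hf.localInverse ∘ φ.symm) (φ (f 0)) := by
      refine (contMDiffAt_iff_contDiffAt.1 (ContMDiffAt.comp (I' := 𝓡 n) (φ (f 0)) ?_
        ((contMDiffOn_extChartAt_symm (f 0)).contMDiffAt
          (extChartAt_target_mem_nhds (f 0))))).differentiableAt (n := ∞) (by simp)
      rw [hφ, extChartAt_to_inv]
      exact hf.localInverse_contMDiffAt
    have hli : (hf.localInverse ∘ φ.symm) (φ (f 0)) = 0 := by
      rw [comp_apply, hφ, extChartAt_to_inv]
      exact hf.localInverse_left_inv hf.localInverse_mem_target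
    have hcomp : (φ ∘ f) ∘ (hf.localInverse ∘ φ.symm) =ᶠ[𝓝 (φ (f 0))] id := by
      filter_upwards [(tendsto_extChartAt_symm_self (f 0)).eventually
        hf.localInverse_eventuallyEq_right, extChartAt_target_mem_nhds (I := 𝓡 n) (f 0)]
        with y hy hyt
      have hy' : f (hf.localInverse (φ.symm y)) = φ.symm y := hy
      simp only [comp_apply, hy', id]
      exact φ.right_inv hyt
    have hc := hcomp.fderiv_eq (𝕜 := ℝ)
    rw [fderiv_id, fderiv_comp _ (by rw [hli]; exact hdf) hf', hli] at hc
    exact fun v => ⟨_, DFunLike.congr_fun hc v⟩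
  have hid : fderiv ℝ (chartConj (f 0) Φ) (φ (f 0)) = ContinuousLinearMap.id ℝ _ := by
    ext1 v
    obtain ⟨w, rfl⟩ := hsurj v
    exact DFunLike.congr_fun hfd w
  rw [← hid]
  exact hΦ.hasFDerivAt

theorem mainTheorem5
    {F : Type*} [NormedAddCommGroup F] [NormedSpace ℝ F] [FiniteDimensional ℝ F]
    {G : Type*} [TopologicalSpace G] [T2Space G] [ChartedSpace F G] [Group G]
    [LieGroup 𝓘(ℝ, F) ∞ G]
    {n : ℕ} {M : Type*} [TopologicalSpace M] [T2Space M]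
    [ChartedSpace (EuclideanSpace ℝ (Fin n)) M] [IsManifold (𝓡 n) ∞ M]
    [MulAction G M] [ContMDiffSMul 𝓘(ℝ, F) (𝓡 n) ∞ G M]
    (hce : ComponentEffective G M)
    (hstab : ∀ q : M, IsCompact (MulAction.stabilizer G q : Set G))
    (ℓ : ℕ) (hℓ : 1 ≤ ℓ) :
    letI : MulAction G (FrameBundle n ℓ M) := prolongedAction n ℓ F G M
    ∀ x : FrameBundle n ℓ M, MulAction.stabilizer G x = ⊥ := by
  let _ : MulAction G (FrameBundle n ℓ M) := prolongedAction n ℓ F G M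
  intro x
  rw [eq_bot_iff]
  intro g hg
  rw [Subgroup.mem_bot]
  induction x using Quotient.inductionOn with
  | h f =>
    have hjet : SameJet ℓ ((fun x : M => g • x) ∘ f.1) f.1 :=
      Quotient.exact (MulAction.mem_stabilizer_iff.1 hg)
    have hq : g • f.1 0 = f.1 0 := hjet.1
    have hd := hjet.hasFDerivAt_chartConj f.2 hℓ
      ((contDiffAt_chartConj_smul (F := F) hq).differentiableAt (by simp))
    by_contra hne
    obtain ⟨x, hx, hgx⟩ := hce g hne (f.1 0)
    exact hgx (smul_eq_self_of_mem_connectedComponent (F := F) hstab hq hd hx)
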